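/- All graphs are finite and simple. A graph is $H$-free if it has no subgraph isomorphic to $H$; an edge $e$ of $H$ is critical if $\chi(H\setminus\{e\})=\chi(H)-1$; $c(G)$ is the number of cycles in $G$ (counted as subgraphs); $T_k(n)$ is the $n$-vertex complete $k$-partite graph with classes of sizes $\lfloor n/k\rfloor$ or $\lceil n/k\rceil$, and $t_k(n)=|E(T_k(n))|$; $\mathrm{ex}(n;H)$ is the maximum number of edges of an $n$-vertex $H$-free graph, and $\mathrm{EX}(n;H)$ is the set of $n$-vertex $H$-free graphs with $\mathrm{ex}(n;H)$ edges, up to isomorphism. Let $k\ge 2$ and let $H$ be a fixed graph with $\chi(H)=k+1$ containing a critical edge. Let $n_0'(H)$ be the smallest integer $N\ge 0$ such that $\mathrm{EX}(n;H)=\{T_k(n)\}$ for all $n\ge N$ (it exists by a theorem of Simonovits), let $n_0(H)$ be the smallest integer $N\ge n_0'(H)$ such that $\mathrm{ex}(n;H)\ge 10n$ for all $n\ge N$, and put $\beta(H)=10\,n_0(H)$. Then there are constants $C$ and $N$, depending only on $H$, such that for all $n\ge N$ and every $H$-free graph $G$ with $n$ vertices and $m$ edges, where $\beta(H)\,n\le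 m\le t_k(n)-10n$, $$c(G)\le C\,\lambda^{n}\,n^{n+2}\left(\frac{k-1}{k}\right)^{n}\exp\left(\frac{2k-1}{(k-1)\lambda}-\lambda n\right),\qquad \lambda=1-\left(1-\frac{2k}{k-1}\cdot\frac{m}{(n-3)^2}\right)^{1/2}.$$ -/

import Mathlib

open SimpleGraph

noncomputable section

namespace CycleCount

/-- `e(F)`: the number of edges of a (finite) graph. -/
def numEdges {V : Type*} (F : SimpleGraph V) : ℕ := F.edgeSet.ncard

/-- `c(G)`: the number of cycles of a (finite) graph, that is, the number of subgraphs of `G`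
that are cycles (the starting point and the direction of traversal do not matter). -/
def numCycles {V : Type*} (G : SimpleGraph V) : ℕ :=
  {S : G.Subgraph | ∃ (v : V) (p : G.Walk v v), p.IsCycle ∧ p.toSubgraph = S}.ncard

/-- The edge `e` of `H` is critical: `χ(H \ {e}) = χ(H) - 1`. -/
def IsCriticalEdge {W : Type*} (H : SimpleGraph W) (e : Sym2 W) : Prop :=
  e ∈ H.edgeSet ∧ (H.deleteEdges {e}).chromaticNumber + 1 = H.chromaticNumber

/-- `t_k(n)`: the number of edges of the Turán graph `T_k(n)`. -/
def turanNumber (k n : ℕ) : ℕ := numEdges (turanGraph n k)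

/-- `EX(n; H)`: the `H`-free graphs on `n` vertices with `ex(n; H)` edges. -/
def extremalGraphs {W : Type*} (n : ℕ) (H : SimpleGraph W) : Set (SimpleGraph (Fin n)) :=
  {G | H.Free G ∧ numEdges G = extremalNumber n H}

/-- `EX(n; H) = {T_k(n)}`, graphs being considered up to isomorphism. -/
def TuranUniqueExtremal {W : Type*} (k n : ℕ) (H : SimpleGraph W) : Prop :=
  ∀ G : SimpleGraph (Fin n), G ∈ extremalGraphs n H ↔ Nonempty (G ≃g turanGraph n k)

/-- `n₀'(H)`: the smallest `N` such that `EX(n; H) = {T_k(n)}` for all `n ≥ N`. -/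
def simonovitsThreshold {W : Type*} (k : ℕ) (H : SimpleGraph W) : ℕ :=
  sInf {N | ∀ n, N ≤ n → TuranUniqueExtremal k n H}

/-- `n₀(H)`: the smallest `N ≥ n₀'(H)` such that `ex(n; H) ≥ 10 n` for all `n ≥ N`. -/
def nZero {W : Type*} (k : ℕ) (H : SimpleGraph W) : ℕ :=
  sInf {N | simonovitsThreshold k H ≤ N ∧ ∀ n, N ≤ n → 10 * n ≤ extremalNumber n H}

/-- `β(H) = 10 n₀(H)`. -/
def beta {W : Type*} (k : ℕ) (H : SimpleGraph W) : ℕ := 10 * nZero k H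

/-- `λ = 1 - (1 - (2k/(k-1)) · m/(n-3)²)^{1/2}`. -/
def lam (k n m : ℕ) : ℝ :=
  1 - √(1 - (2 * (k : ℝ)) / ((k : ℝ) - 1) * ((m : ℝ) / ((n : ℝ) - 3) ^ 2))

end CycleCount

end

open Finset Filter

/-! Put b = (k-1)/k. Deleting an edge from a cycle leaves a path whose vertex sequence determines
the cycle, so it suffices to bound, for each start and each length, the number of paths. Walking
along a path, the number of choices at each step is the degree of the current vertex into the
unvisited set, and these degrees sum to at most m. The inequality d ≤ c·exp(d/c - 1), valid for any
c > 0, turns their product into an exponential of their sum.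

While more than X vertices are unvisited, c = bX is used (`card_pathLists_le_of_le_card`). Once X
vertices are left, c = b|S| follows the shrinking set S (`card_pathLists_le`). This needs every
large S to span at most b|S|²/2 edges, which is the upper bound in Simonovits' theorem
(`exists_forall_adjPairs_le`). Up to constants the outcome is (bX)^n exp(-n - X/2 + m/(bX)). The
choice X ≈ λn (`exists_parameter`) is natural because λ - λ²/2 is essentially m/(bn²)
(`lam_bounds`), so that the exponent becomes -λn, and the terms of order 1/λ pay for rounding X.

Simonovits' bound comes from stability: a large H-free graph of minimum degree about bn is
k-colourable (`colorable_of_card_nonadj_le`), and vertices of smaller degree are deleted one at a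
time. -/

namespace SimpleGraph

variable {V : Type*} {G : SimpleGraph V}

/-! ### Embedding a graph with a critical edge; greedy choice of complete multipartite graphs. -/

/-- The sets `A i` are pairwise completely joined in `G`. -/
def IsCompleteFamily {ι : Type*} (G : SimpleGraph V) (A : ι → Finset V) : Prop :=
  ∀ i j, i ≠ j → ∀ a ∈ A i, ∀ b ∈ A j, G.Adj a b

/-- `G` contains a complete `k`-partite graph with classes of size at least `t`, together with
an edge inside one of the classes. -/
def HasMultipartitePlusEdge (G : SimpleGraph V) (k t : ℕ) : Prop :=
  ∃ A : Fin k → Finset V, G.IsCompleteFamily A ∧ (∀ i, t ≤ #(A i)) ∧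
    ∃ i, ∃ u ∈ A i, ∃ v ∈ A i, G.Adj u v

theorem exists_embedding_into_finset {W : Type*} [Fintype W] (A : Finset V)
    (hA : Fintype.card W ≤ #A) : ∃ f : W ↪ V, ∀ w, f w ∈ A := by
  have : Fintype.card W ≤ Fintype.card A := by simpa using hA
  obtain ⟨f⟩ := Function.Embedding.nonempty_of_card_le this
  exact ⟨f.trans (Function.Embedding.subtype _), fun w => (f w).2⟩

theorem exists_embedding_into_finset_of_two {W : Type*} [Fintype W] (A : Finset V)
    (hA : Fintype.card W ≤ #A) {x y : W} (hxy : x ≠ y) {u v : V} (hu : u ∈ A) (hv : v ∈ A)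
    (huv : u ≠ v) : ∃ f : W ↪ V, (∀ w, f w ∈ A) ∧ f x = u ∧ f y = v := by
  classical
  have : Fintype.card W ≤ Fintype.card A := by simpa using hA
  obtain ⟨f⟩ := Function.Embedding.nonempty_of_card_le this
  let g : W ↪ A := f.trans (Equiv.swap (f x) ⟨u, hu⟩).toEmbedding
  have gx : g x = ⟨u, hu⟩ := by simp [g]
  let h : W ↪ A := g.trans (Equiv.swap (g y) ⟨v, hv⟩).toEmbedding
  have hy : h y = ⟨v, hv⟩ := by simp [h]
  have hx : h x = ⟨u, hu⟩ := by
    simp only [h, Function.Embedding.trans_apply, gx, Equiv.coe_toEmbedding]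
    rw [Equiv.swap_apply_of_ne_of_ne]
    · rw [← gx]; exact fun h => hxy (g.injective h)
    · simpa using huv
  exact ⟨h.trans (Function.Embedding.subtype _), fun w => (h w).2, by simp [hx], by simp [hy]⟩

/-- Without its critical edge xy, H is k-colourable, and x and y get the same colour since H itself
is not. So the colour classes fit into the classes of the host, with xy placed on the additional
edge. -/
theorem isContained_of_hasMultipartitePlusEdge {W : Type*} [Fintype W] {H : SimpleGraph W}
    {k : ℕ} (hχ : H.chromaticNumber = ((k + 1 : ℕ) : ℕ∞))
    (hcrit : ∃ e : Sym2 W, CycleCount.IsCriticalEdge H e)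
    (hG : G.HasMultipartitePlusEdge k (Fintype.card W)) : H ⊑ G := by
  classical
  obtain ⟨e, he, hcr⟩ := hcrit
  induction e with | h x y => ?_
  have hcol : (H.deleteEdges {s(x, y)}).Colorable k := by
    rw [hχ] at hcr
    rw [← chromaticNumber_le_iff_colorable]
    push_cast at hcr
    exact (ENat.add_left_injective_of_ne_top ENat.one_ne_top hcr).le
  obtain ⟨c⟩ := hcol
  rw [mem_edgeSet] at he
  have hadj : ∀ {a b}, H.Adj a b → s(a, b) ≠ s(x, y) → c a ≠ c b := fun h h' =>
    c.valid (by rw [deleteEdges_adj]; exact ⟨h, h'⟩)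
  have hcxy : c x = c y := by
    by_contra hne
    have : H.Colorable k := by
      refine ⟨Coloring.mk c ?_⟩
      intro a b hab
      by_cases h' : s(a, b) = s(x, y)
      · rcases Sym2.eq_iff.1 h' with ⟨rfl, rfl⟩ | ⟨rfl, rfl⟩
        · exact hne
        · exact fun h => hne h.symm
      · exact hadj hab h'
    rw [← chromaticNumber_le_iff_colorable, hχ] at this
    have : k + 1 ≤ k := by exact_mod_cast this
    omega
  obtain ⟨A, hA, hcard, i, u, hu, v, hv, huv⟩ := hG
  have hf : ∀ j, ∃ f : W ↪ V, (∀ w, f w ∈ A j) ∧ (j = i → f x = u ∧ f y = v) := by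
    intro j
    by_cases hj : j = i
    · subst hj
      obtain ⟨f, h1, h2⟩ := exists_embedding_into_finset_of_two (A j) (hcard j) he.ne hu hv huv.ne
      exact ⟨f, h1, fun _ => h2⟩
    · obtain ⟨f, h1⟩ := exists_embedding_into_finset (A j) (hcard j)
      exact ⟨f, h1, fun h => absurd h hj⟩
  choose f hfA hfi using hf
  -- Colours are permuted so that the common colour of x and y becomes i, the class with the
  -- additional edge.
  let d : W → Fin k := fun w => Equiv.swap (c x) i (c w)
  have hdx : d x = i := by simp [d]
  have hdy : d y = i := by simp [d, ← hcxy]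
  have hd : ∀ {a b}, c a ≠ c b → d a ≠ d b := fun h h' => h ((Equiv.injective _) h')
  refine ⟨⟨⟨fun w => f (d w) w, ?_⟩, ?_⟩⟩
  · intro a b hab
    by_cases h' : s(a, b) = s(x, y)
    · rcases Sym2.eq_iff.1 h' with ⟨rfl, rfl⟩ | ⟨rfl, rfl⟩
      · simpa [hdx, hdy, hfi] using huv
      · simpa [hdx, hdy, hfi] using huv.symm
    · exact hA _ _ (hd (hadj hab h')) _ (hfA _ _) _ (hfA _ _)
  · intro a b hab
    change f (d a) a = f (d b) b at hab
    by_cases h : d a = d b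
    · rw [h] at hab
      exact (f (d b)).injective hab
    · exact absurd hab (hA _ _ h _ (hfA _ a) _ (hfA _ b)).ne

/-- Large sets with few missing edges between them contain a complete multipartite graph. -/
theorem exists_isCompleteFamily_of_few_nonadj [DecidableRel G.Adj] {k t q : ℕ}
    (B : Fin k → Finset V)
    (hq : ∀ i j, i ≠ j → ∀ v ∈ B i, #{w ∈ B j | ¬ G.Adj v w} ≤ q)
    (hB : ∀ i, k * t * q + t ≤ #(B i)) :
    ∃ A : Fin k → Finset V, G.IsCompleteFamily A ∧ ∀ i, A i ⊆ B i ∧ #(A i) = t := by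
  classical
  suffices h : ∀ J : Finset (Fin k), ∃ A : Fin k → Finset V,
      (∀ i ∈ J, ∀ j ∈ J, i ≠ j → ∀ a ∈ A i, ∀ b ∈ A j, G.Adj a b) ∧
      ∀ i ∈ J, A i ⊆ B i ∧ #(A i) = t by
    obtain ⟨A, h1, h2⟩ := h univ
    exact ⟨A, fun i j => h1 i (mem_univ _) j (mem_univ _), fun i => h2 i (mem_univ _)⟩
  intro J
  induction J using Finset.induction_on with
  | empty => exact ⟨fun _ => ∅, by simp, by simp⟩
  | insert i J hi ih =>
    obtain ⟨A, hA, hAB⟩ := ih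
    -- At most kt vertices have been chosen so far, and each excludes at most q vertices of `B i`.
    let bad : Finset V := J.biUnion fun j => (A j).biUnion fun a => {w ∈ B i | ¬ G.Adj a w}
    have hbad : #bad ≤ k * t * q := by
      calc #bad ≤ ∑ j ∈ J, #((A j).biUnion fun a => {w ∈ B i | ¬ G.Adj a w}) := card_biUnion_le
        _ ≤ ∑ j ∈ J, t * q := by
            refine sum_le_sum fun j hj => ?_
            rw [← (hAB j hj).2]
            refine card_biUnion_le_card_mul _ _ _ fun a ha => ?_
            refine hq j i ?_ a ((hAB j hj).1 ha)
            rintro rfl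
            exact hi hj
        _ = #J * (t * q) := by simp
        _ ≤ k * (t * q) := by
            gcongr
            simpa using card_le_univ J
        _ = k * t * q := by ring
    have hsize : t ≤ #(B i \ bad) := by
      have := le_card_sdiff bad (B i)
      have := hB i
      omega
    obtain ⟨A', hA's, hA'c⟩ := exists_subset_card_eq hsize
    have hadj : ∀ j ∈ J, ∀ a ∈ A j, ∀ b ∈ A', G.Adj a b := by
      intro j hj a ha b hb
      have hb' := mem_sdiff.1 (hA's hb)
      by_contra hab
      exact hb'.2 (mem_biUnion.2 ⟨j, hj, mem_biUnion.2 ⟨a, ha, mem_filter.2 ⟨hb'.1, hab⟩⟩⟩)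
    refine ⟨Function.update A i A', ?_, ?_⟩
    · intro a ha b hb hab
      rcases mem_insert.1 ha with rfl | ha' <;> rcases mem_insert.1 hb with rfl | hb'
      · exact absurd rfl hab
      · rw [Function.update_self, Function.update_of_ne hab.symm]
        exact fun x hx y hy => (hadj b hb' y hy x hx).symm
      · rw [Function.update_self, Function.update_of_ne hab]
        exact fun x hx y hy => hadj a ha' x hx y hy
      · rw [Function.update_of_ne (by rintro rfl; exact hi ha'),
          Function.update_of_ne (by rintro rfl; exact hi hb')]
        exact hA a ha' b hb' hab
    · intro j hj
      rcases mem_insert.1 hj with rfl | hj'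
      · rw [Function.update_self]
        exact ⟨hA's.trans sdiff_subset, hA'c⟩
      · rw [Function.update_of_ne (by rintro rfl; exact hi hj')]
        exact hAB j hj'

/-! ### Minimum degree Erdős–Stone. -/

section MinDegree

variable [Fintype V] [DecidableRel G.Adj]

theorem sum_card_nonadj_le {ι : Type*} [Fintype ι] (A : ι → Finset V) {M : ℝ}
    (hM : ∀ v, (#{w | ¬ G.Adj v w} : ℝ) ≤ M) :
    ∑ v, ∑ i, (#{a ∈ A i | ¬ G.Adj v a} : ℝ) ≤ ∑ i, (#(A i) : ℝ) * M := by
  rw [sum_comm]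
  refine sum_le_sum fun i _ => ?_
  have : ∑ v, (#{a ∈ A i | ¬ G.Adj v a} : ℝ) = ∑ a ∈ A i, (#{v | ¬ G.Adj a v} : ℝ) := by
    have := sum_card_bipartiteAbove_eq_sum_card_bipartiteBelow (s := univ) (t := A i)
      (fun v a => ¬ G.Adj v a)
    simp only [bipartiteAbove, bipartiteBelow] at this
    simp only [G.adj_comm] at this ⊢
    exact_mod_cast this
  rw [this, ← nsmul_eq_mul]
  exact sum_le_card_nsmul _ _ _ fun a _ => hM a

/-- The minimum degree Erdős–Stone theorem, in terms of non-neighbours. -/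
theorem exists_isCompleteFamily_of_card_nonadj_le (k s : ℕ) (hk : 2 ≤ k) :
    ∃ N : ℕ, ∀ (V : Type) [Fintype V] (G : SimpleGraph V) [DecidableRel G.Adj],
      N ≤ Fintype.card V →
      (∀ v, (#{w | ¬ G.Adj v w} : ℝ) ≤ Fintype.card V / k + 1) →
      ∃ A : Fin k → Finset V, G.IsCompleteFamily A ∧ ∀ i, #(A i) = s := by
  classical
  obtain ⟨r, rfl⟩ : ∃ r, k = r + 1 := ⟨k - 1, by omega⟩
  have hr : (1 : ℝ) ≤ r := by exact_mod_cast (by omega : 1 ≤ r)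
  -- Half of 1/r - 1/(r+1): one half meets the excess required by Erdős–Stone, the other absorbs the
  -- +1 in the hypothesis.
  set ε : ℝ := 1 / (2 * r * (r + 1)) with hε
  have hε0 : 0 < ε := by positivity
  obtain ⟨N, hN⟩ := eventually_atTop.1
    (eventually_completeEquipartiteGraph_isContained_of_minDegree hε0 r s)
  refine ⟨max (max N 1) ⌈1 / ε⌉₊, fun V _ G _ hV hM => ?_⟩
  set n := Fintype.card V with hn
  have hn1 : 1 ≤ n := by omega
  have hnε : 1 / ε ≤ n := (Nat.le_ceil _).trans (by exact_mod_cast (le_max_right _ _).trans hV)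
  let e : Fin n ≃ V := (Fintype.equivFin V).symm
  let φ : G.comap e ≃g G := Iso.comap e G
  have hdeg : ∀ v, (G.degree v : ℝ) = n - #{w | ¬ G.Adj v w} := by
    intro v
    have := card_filter_add_card_filter_not (s := (univ : Finset V)) (fun w => G.Adj v w)
    rw [← card_neighborFinset_eq_degree, neighborFinset_eq_filter, eq_sub_iff_add_eq]
    rw [card_univ] at this
    exact_mod_cast this
  have : Nonempty (Fin n) := ⟨⟨0, hn1⟩⟩
  have hmin : ((G.comap e).minDegree : ℝ) ≥ (1 - 1 / r + ε) * n := by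
    obtain ⟨v, hv⟩ := (G.comap e).exists_minimal_degree_vertex
    rw [hv, ← φ.degree_eq, hdeg]
    have h1 := hM (φ v)
    have h2 : 1 ≤ ε * n := by rwa [div_le_iff₀' hε0] at hnε
    have h3 : (n : ℝ) / ((r + 1 : ℕ) : ℝ) = n / r - 2 * (ε * n) := by
      rw [hε]; push_cast; field_simp; ring
    rw [h3] at h1
    have : (1 - 1 / r + ε) * n = n - n / r + ε * n := by ring
    rw [this]; linarith
  obtain ⟨f⟩ := (hN n (by omega) hmin).trans ⟨φ.toCopy⟩
  refine ⟨fun i => univ.image fun x : Fin s => f (i, x), ?_, ?_⟩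
  · intro i j hij a ha b hb
    obtain ⟨x, -, rfl⟩ := mem_image.1 ha
    obtain ⟨y, -, rfl⟩ := mem_image.1 hb
    exact f.toHom.map_adj (by rw [completeEquipartiteGraph_adj]; exact hij)
  · intro i
    rw [card_image_of_injective, card_univ, Fintype.card_fin]
    intro x y hxy
    exact (Prod.ext_iff.1 (f.injective hxy)).2

end MinDegree

end SimpleGraph

/-! ### Minimum degree stability: k-colourability. -/

namespace SimpleGraph

variable {V : Type*} {G : SimpleGraph V}

theorem exists_isCompleteFamily_of_card_nonadj_le_real [DecidableRel G.Adj] {k t : ℕ} {q : ℝ}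
    (hq0 : 0 ≤ q) (B : Fin k → Finset V)
    (hq : ∀ i j, i ≠ j → ∀ v ∈ B i, (#{w ∈ B j | ¬ G.Adj v w} : ℝ) ≤ q)
    (hB : ∀ i, k * t * q + t ≤ (#(B i) : ℝ)) :
    ∃ A : Fin k → Finset V, G.IsCompleteFamily A ∧ ∀ i, A i ⊆ B i ∧ #(A i) = t := by
  refine exists_isCompleteFamily_of_few_nonadj (q := ⌊q⌋₊) B
    (fun i j hij v hv => Nat.le_floor (hq i j hij v hv)) fun i => ?_
  have h1 := Nat.floor_le hq0
  have h2 : (k * t * ⌊q⌋₊ + t : ℝ) ≤ #(B i) := (hB i).trans' (by gcongr)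
  exact_mod_cast h2

theorem hasMultipartitePlusEdge_of_adj {k t : ℕ} {B : Fin k → Finset V}
    (hB : G.IsCompleteFamily B) (ht : ∀ i, t ≤ #(B i)) (i : Fin k) {u v : V} (huv : G.Adj u v)
    (hu : ∀ j, j ≠ i → ∀ b ∈ B j, G.Adj u b) (hv : ∀ j, j ≠ i → ∀ b ∈ B j, G.Adj v b) :
    G.HasMultipartitePlusEdge k t := by
  classical
  have key : ∀ j, j ≠ i → ∀ a ∈ insert u (insert v (B i)), ∀ b ∈ B j, G.Adj a b := by
    intro j hj a ha b hb
    rcases mem_insert.1 ha with rfl | ha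
    · exact hu j hj b hb
    rcases mem_insert.1 ha with rfl | ha
    · exact hv j hj b hb
    exact hB i j hj.symm a ha b hb
  refine ⟨Function.update B i (insert u (insert v (B i))), ?_, ?_, i, u, by simp, v, by simp, huv⟩
  · intro a b hab
    by_cases ha : a = i
    · subst ha
      rw [Function.update_self, Function.update_of_ne hab.symm]
      exact key b hab.symm
    · rw [Function.update_of_ne ha]
      by_cases hb : b = i
      · subst hb
        rw [Function.update_self]
        exact fun x hx y hy => (key a ha y hy x hx).symm
      · rw [Function.update_of_ne hb]
        exact hB a b hab
  · intro j
    by_cases hj : j = i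
    · subst hj
      rw [Function.update_self]
      exact (ht j).trans (card_le_card fun x hx => by simp [hx])
    · rw [Function.update_of_ne hj]
      exact ht j

/-- The vertex v can join any class, where an edge from v to an old member is the additional edge.
-/
theorem hasMultipartitePlusEdge_of_forall_adj {k t : ℕ} {B : Fin k → Finset V}
    (hB : G.IsCompleteFamily B) (ht : ∀ i, t ≤ #(B i)) (hk : 0 < k) (ht0 : 0 < t) {v : V}
    (hv : ∀ j, ∀ b ∈ B j, G.Adj v b) : G.HasMultipartitePlusEdge k t := by
  let i : Fin k := ⟨0, hk⟩
  obtain ⟨w, hw⟩ := card_pos.1 (ht0.trans_le (ht i))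
  exact hasMultipartitePlusEdge_of_adj hB ht i (hv i w hw) (fun j _ => hv j)
    fun j hj b hb => hB i j hj.symm w hw b hb

theorem card_sub_le_card_filter_adj [DecidableRel G.Adj] (A : Finset V) (u v : V) :
    (#A : ℝ) - #{a ∈ A | ¬ G.Adj u a} - #{a ∈ A | ¬ G.Adj v a} ≤
      #{a ∈ A | G.Adj u a ∧ G.Adj v a} := by
  classical
  have : #A ≤ #{a ∈ A | G.Adj u a ∧ G.Adj v a} + (#{a ∈ A | ¬ G.Adj u a} +
      #{a ∈ A | ¬ G.Adj v a}) := by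
    refine (card_le_card ?_).trans ((card_union_le _ _).trans
      (Nat.add_le_add_left (card_union_le _ _) _))
    intro a ha
    simp only [mem_union, mem_filter, ha, true_and]
    tauto
  have : (#A : ℝ) ≤ #{a ∈ A | G.Adj u a ∧ G.Adj v a} + (#{a ∈ A | ¬ G.Adj u a} +
      #{a ∈ A | ¬ G.Adj v a}) := by exact_mod_cast this
  linarith

/-- A large graph of minimum degree about `(1 - 1/k) n` which does not contain a complete
`k`-partite graph with an additional edge inside a class is `k`-colorable. -/
theorem colorable_of_card_nonadj_le (k t : ℕ) (hk : 2 ≤ k) (ht : 1 ≤ t) :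
    ∃ N : ℕ, ∀ (V : Type) [Fintype V] (G : SimpleGraph V) [DecidableRel G.Adj],
      N ≤ Fintype.card V →
      (∀ v, (#{w | ¬ G.Adj v w} : ℝ) ≤ Fintype.card V / k + 1) →
      ¬ G.HasMultipartitePlusEdge k t → G.Colorable k := by
  classical
  obtain ⟨N, hN⟩ := exists_isCompleteFamily_of_card_nonadj_le k (128 * k ^ 2 * t ^ 2) hk
  refine ⟨max N (16 * k * (8 * k ^ 2 * t + t + 3 * k)), fun V _ G _ hV hM hG => ?_⟩
  obtain ⟨A, hA, hAs⟩ := hN V G (by omega) hM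
  have hn : 16 * k * (8 * k ^ 2 * t + t + 3 * k) ≤ Fintype.card V := (le_max_right _ _).trans hV
  set n := Fintype.card V with hndef
  set s := 128 * k ^ 2 * t ^ 2 with hs
  have hk' : (2 : ℝ) ≤ k := by exact_mod_cast hk
  have ht' : (1 : ℝ) ≤ t := by exact_mod_cast ht
  have hsR : (s : ℝ) = 128 * k ^ 2 * t ^ 2 := by rw [hs]; push_cast; ring
  have hts : (4 * t : ℝ) ≤ s := by
    rw [hsR]
    nlinarith [mul_le_mul hk' ht' zero_le_one (by positivity), mul_pos (by positivity : (0:ℝ) < t)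
      (by positivity : (0:ℝ) < t)]
  -- The unit p is a sixteenth of the ideal class size n/k; all later errors are small multiples of
  -- it.
  obtain ⟨p, hp⟩ : ∃ p : ℝ, (n : ℝ) = 16 * k * p := ⟨n / (16 * k), by field_simp⟩
  have hp1 : (8 * k ^ 2 * t + t + 3 * k : ℝ) ≤ p := by
    have : (16 * k * (8 * k ^ 2 * t + t + 3 * k) : ℝ) ≤ 16 * k * p := by
      rw [← hp]; exact_mod_cast hn
    exact le_of_mul_le_mul_left this (by positivity)
  have hp0 : 0 < p := hp1.trans_lt' (by positivity)
  set D : ℝ := p / (k * t) with hD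
  have hDp : k * t * D = p := by rw [hD]; field_simp
  have hD0 : 0 < D := by positivity
  have hDle : D ≤ p := by
    rw [hD]; exact div_le_self hp0.le (by nlinarith)
  have hDk : 8 * k ≤ D := by
    rw [hD, le_div_iff₀ (by positivity)]
    nlinarith
  have hnk : (n : ℝ) / k = 16 * p := by rw [hp]; field_simp
  rw [hnk] at hM
  -- a class in which a vertex has few neighbours
  have hfew : ∀ v, ∃ i, #{a ∈ A i | G.Adj v a} < t := by
    intro v
    by_contra! h
    exact hG (hasMultipartitePlusEdge_of_forall_adj (B := fun i => {a ∈ A i | G.Adj v a})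
      (fun i j hij a ha b hb => hA i j hij a (mem_filter.1 ha).1 b (mem_filter.1 hb).1) h
      (by omega) ht (fun j b hb => (mem_filter.1 hb).2))
  choose h hh using hfew
  have hh' : ∀ v, (s : ℝ) - t ≤ #{a ∈ A (h v) | ¬ G.Adj v a} := by
    intro v
    have h1 := card_filter_add_card_filter_not (s := A (h v)) (fun w => G.Adj v w)
    rw [hAs] at h1
    have h2 := hh v
    have h3 : s ≤ #{a ∈ A (h v) | ¬ G.Adj v a} + t := by omega
    rw [sub_le_iff_le_add]
    exact_mod_cast h3
  -- Every vertex already misses at least s - t vertices of `A (h v)`, while the total number of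
  -- missing pairs is at most s(n + k). Hence |bad| ≤ 4k + 4nt/s; by the choice of s the last term
  -- is D/2, and D ≥ 8k.
  let bad : Finset V := {v | ∃ j, j ≠ h v ∧ (s / 4 : ℝ) < #{a ∈ A j | ¬ G.Adj v a}}
  have hbad : (#bad : ℝ) ≤ D := by
    have h1 := sum_card_nonadj_le A hM
    have h2 : ∀ v, (s : ℝ) - t + (if v ∈ bad then (s / 4 : ℝ) else 0) ≤
        ∑ i, (#{a ∈ A i | ¬ G.Adj v a} : ℝ) := by
      intro v
      rw [← add_sum_erase _ _ (mem_univ (h v))]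
      refine add_le_add (hh' v) ?_
      split_ifs with hv
      · obtain ⟨j, hj, hj'⟩ := (mem_filter.1 hv).2
        exact hj'.le.trans (single_le_sum (f := fun i => (#{a ∈ A i | ¬ G.Adj v a} : ℝ))
          (fun i _ => by positivity) (mem_erase.2 ⟨hj, mem_univ j⟩))
      · exact sum_nonneg fun i _ => by positivity
    have h3 := (sum_le_sum fun v (_ : v ∈ univ) => h2 v).trans h1
    rw [sum_add_distrib, ← sum_filter] at h3
    simp only [sum_const, hAs, card_univ, nsmul_eq_mul, Fintype.card_fin, filter_mem_eq_inter,
      univ_inter] at h3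
    rw [← hndef, hp] at h3
    have h4 : (#bad : ℝ) * s ≤ D * s := by
      have h5 : D * s = 128 * (k * t * D) * k * t := by rw [hsR]; ring
      have h6 : 8 * k * s ≤ D * s := by gcongr
      rw [hDp] at h5
      nlinarith
    exact le_of_mul_le_mul_right h4 (by rw [hsR]; positivity)
  let U : Fin k → Finset V := fun i => {v | v ∉ bad ∧ h v = i}
  have hgood : ∀ {v i j}, v ∈ U i → j ≠ i → (#{a ∈ A j | ¬ G.Adj v a} : ℝ) ≤ s / 4 := by
    intro v i j hv hj
    obtain ⟨h1, rfl⟩ := (mem_filter.1 hv).2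
    by_contra! h2
    exact h1 (mem_filter.2 ⟨mem_univ _, j, hj, h2⟩)
  -- Two vertices of `U i` have at least s/2 ≥ t common neighbours in every other `A j`, so an edge
  -- between them would be a forbidden additional edge.
  have hindep : ∀ {i u v}, u ∈ U i → v ∈ U i → ¬ G.Adj u v := by
    intro i u v hu hv huv
    let B : Fin k → Finset V :=
      Function.update (fun j => {a ∈ A j | G.Adj u a ∧ G.Adj v a}) i (A i)
    have hBA : ∀ j, B j ⊆ A j := by
      intro j
      by_cases hj : j = i
      · subst hj; simp [B]
      · simp [B, Function.update_of_ne hj]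
    refine hG (hasMultipartitePlusEdge_of_adj (B := B)
      (fun a b hab x hx y hy => hA a b hab x (hBA a hx) y (hBA b hy)) ?_ i huv ?_ ?_)
    · intro j
      by_cases hj : j = i
      · subst hj
        simp only [B, Function.update_self, hAs]
        have : (t : ℝ) ≤ s := by linarith
        exact_mod_cast this
      · simp only [B, Function.update_of_ne hj]
        have h1 := card_sub_le_card_filter_adj (G := G) (A j) u v
        have h2 := hgood hu hj
        have h3 := hgood hv hj
        rw [hAs] at h1
        have : (t : ℝ) ≤ #{a ∈ A j | G.Adj u a ∧ G.Adj v a} := by linarith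
        exact_mod_cast this
    · intro j hj b hb
      simp only [B, Function.update_of_ne hj] at hb
      exact (mem_filter.1 hb).2.1
    · intro j hj b hb
      simp only [B, Function.update_of_ne hj] at hb
      exact (mem_filter.1 hb).2.2
  have hUle : ∀ i, (#(U i) : ℝ) ≤ 16 * p + 1 := by
    intro i
    rcases (U i).eq_empty_or_nonempty with h0 | ⟨v, hv⟩
    · rw [h0, card_empty, Nat.cast_zero]; positivity
    · refine (hM v).trans' ?_
      exact_mod_cast card_le_card fun w hw => mem_filter.2 ⟨mem_univ _, hindep hv hw⟩
  have hUge : ∀ i, 16 * p - D - (k - 1) ≤ (#(U i) : ℝ) := by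
    intro i
    have h1 : #(univ \ bad) = ∑ i, #(U i) := by
      rw [card_eq_sum_card_fiberwise (f := h) (t := univ) (fun _ _ => mem_univ _)]
      refine sum_congr rfl fun i _ => congrArg _ ?_
      ext v; simp [U]
    have h2 : (n : ℝ) ≤ #(univ \ bad) + #bad := by
      have := le_card_sdiff bad (univ : Finset V)
      rw [card_univ] at this
      exact_mod_cast (by omega : n ≤ #(univ \ bad) + #bad)
    rw [h1, ← add_sum_erase _ _ (mem_univ i)] at h2
    push_cast at h2
    have h3 : ∑ j ∈ univ.erase i, (#(U j) : ℝ) ≤ (k - 1) * (16 * p + 1) := by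
      have := sum_le_card_nsmul (univ.erase i) (fun j => (#(U j) : ℝ)) _ fun j _ => hUle j
      rw [card_erase_of_mem (mem_univ i), card_univ, Fintype.card_fin, nsmul_eq_mul,
        Nat.cast_sub (by omega), Nat.cast_one] at this
      exact this
    rw [hp] at h2
    linarith
  have hdisj : ∀ i j, i ≠ j → Disjoint (U i) (U j) := by
    intro i j hij
    rw [Finset.disjoint_left]
    intro v hv hv'
    exact hij ((mem_filter.1 hv).2.2.symm.trans (mem_filter.1 hv').2.2)
  have hsplit : ∀ x i j, i ≠ j →
      (#{w ∈ U i | ¬ G.Adj x w} : ℝ) + #{w ∈ U j | ¬ G.Adj x w} ≤ 16 * p + 1 := by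
    intro x i j hij
    refine (hM x).trans' ?_
    rw [← Nat.cast_add, ← card_union_of_disjoint
      ((hdisj i j hij).mono (filter_subset _ _) (filter_subset _ _))]
    refine Nat.cast_le.2 (card_le_card ?_)
    intro w hw
    rcases mem_union.1 hw with hw | hw <;> exact mem_filter.2 ⟨mem_univ _, (mem_filter.1 hw).2⟩
  -- The independent set `U i` nearly exhausts the 16p + 1 non-neighbours allowed to v.
  have hq : ∀ i j, i ≠ j → ∀ v ∈ U i, (#{w ∈ U j | ¬ G.Adj v w} : ℝ) ≤ D + k := by
    intro i j hij v hv
    have h1 := hsplit v i j hij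
    rw [filter_true_of_mem fun w hw => hindep hv hw] at h1
    linarith [hUge i]
  have hq0 : 0 ≤ D + k := by positivity
  have hqs : k * t * (D + k) + t ≤ 2 * p := by nlinarith
  -- This includes the bad vertices: sets of size 2p suffice for the greedy choice, so a vertex with
  -- 2p neighbours in every `U i` would be joined to a whole complete family.
  have hclass : ∀ x, ∃ i, (#{w ∈ U i | G.Adj x w} : ℝ) < 2 * p := by
    intro x
    by_contra! hx
    obtain ⟨B, hB, hBs⟩ := exists_isCompleteFamily_of_card_nonadj_le_real (G := G) (t := t) hq0
      (fun i => {w ∈ U i | G.Adj x w})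
      (fun i j hij v hv => (hq i j hij v (mem_filter.1 hv).1).trans'
        (by exact_mod_cast card_le_card (filter_subset_filter _ (filter_subset _ _))))
      (fun i => hqs.trans (hx i))
    exact hG (hasMultipartitePlusEdge_of_forall_adj hB (fun i => (hBs i).2.ge) (by omega) ht
      (v := x) (fun j b hb => (mem_filter.1 ((hBs j).1 hb)).2))
  choose g hg using hclass
  have hgj : ∀ x j, j ≠ g x → (#{w ∈ U j | ¬ G.Adj x w} : ℝ) ≤ D + k + 2 * p := by
    intro x j hj
    have h1 := hsplit x (g x) j hj.symm
    have h2 := card_filter_add_card_filter_not (s := U (g x)) (fun w => G.Adj x w)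
    have h3 : (#{w ∈ U (g x) | G.Adj x w} : ℝ) + #{w ∈ U (g x) | ¬ G.Adj x w} = #(U (g x)) := by
      exact_mod_cast h2
    linarith [hUge (g x), hg x]
  -- Two adjacent vertices of the same colour would have at least 2p common neighbours in each of
  -- the other sets `U j`, again giving the forbidden configuration.
  refine ⟨Coloring.mk g ?_⟩
  intro u v huv hguv
  let B : Fin k → Finset V :=
    Function.update (fun j => {w ∈ U j | G.Adj u w ∧ G.Adj v w}) (g u) (U (g u))
  have hBU : ∀ j, B j ⊆ U j := by
    intro j
    by_cases hj : j = g u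
    · subst hj; simp [B]
    · simp [B, Function.update_of_ne hj]
  have hsize : ∀ j, k * t * (D + k) + t ≤ (#(B j) : ℝ) := by
    intro j
    refine hqs.trans ?_
    by_cases hj : j = g u
    · subst hj
      simp only [B, Function.update_self]
      nlinarith [hUge (g u)]
    · simp only [B, Function.update_of_ne hj]
      have h1 := card_sub_le_card_filter_adj (G := G) (U j) u v
      have h2 := hgj u j hj
      have h3 := hgj v j (hguv ▸ hj)
      nlinarith [hUge j]
  obtain ⟨C, hC, hCs⟩ := exists_isCompleteFamily_of_card_nonadj_le_real (G := G) (t := t) hq0 B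
    (fun i j hij v hv => (hq i j hij v (hBU i hv)).trans'
      (by exact_mod_cast card_le_card (filter_subset_filter _ (hBU j)))) hsize
  refine hG (hasMultipartitePlusEdge_of_adj hC (fun i => (hCs i).2.ge) (g u) huv ?_ ?_)
  · intro j hj b hb
    have := (hCs j).1 hb
    simp only [B, Function.update_of_ne hj] at this
    exact (mem_filter.1 this).2.1
  · intro j hj b hb
    have := (hCs j).1 hb
    simp only [B, Function.update_of_ne hj] at this
    exact (mem_filter.1 this).2.2

end SimpleGraph

/-! ### Edges inside vertex sets: Simonovits' upper bound. -/

namespace SimpleGraph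

variable {V : Type*} (G : SimpleGraph V) [DecidableRel G.Adj]

/-- The number of ordered pairs of adjacent vertices in `S`, which is twice the number of edges
inside `S`. -/
def adjPairs (S : Finset V) : ℕ := ∑ v ∈ S, #{w ∈ S | G.Adj v w}

variable {G}

theorem adjPairs_erase [DecidableEq V] {S : Finset V} {v : V} (hv : v ∈ S) :
    G.adjPairs S = G.adjPairs (S.erase v) + 2 * #{w ∈ S | G.Adj v w} := by
  have h : ∀ u, #{w ∈ S | G.Adj u w} =
      #{w ∈ S.erase v | G.Adj u w} + if G.Adj u v then 1 else 0 := by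
    intro u
    conv_lhs => rw [← insert_erase hv]
    rw [filter_insert]
    split_ifs with huv
    · rw [card_insert_of_notMem (by simp)]
    · rfl
  unfold adjPairs
  rw [← add_sum_erase _ _ hv, sum_congr rfl fun u _ => h u, sum_add_distrib, ← card_filter,
    h v, if_neg G.irrefl]
  simp only [G.adj_comm _ v]
  ring

theorem adjPairs_le_sq (S : Finset V) : G.adjPairs S ≤ #S ^ 2 := by
  rw [adjPairs, sq]
  exact sum_le_card_nsmul _ _ _ fun v _ => card_filter_le _ _

/-- Each vertex misses its own colour class, and Cauchy–Schwarz bounds the sum of the squared class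
sizes from below. -/
theorem adjPairs_le_of_coloring {k : ℕ} (hk : 1 ≤ k) {S : Finset V} (c : V → Fin k)
    (hc : ∀ u ∈ S, ∀ v ∈ S, G.Adj u v → c u ≠ c v) :
    (G.adjPairs S : ℝ) ≤ (k - 1) / k * #S ^ 2 := by
  classical
  have h1 : ∀ v ∈ S, (#{w ∈ S | G.Adj v w} : ℝ) ≤ #S - #{w ∈ S | c w = c v} := by
    intro v hv
    rw [le_sub_iff_add_le, ← Nat.cast_add, ← card_union_of_disjoint]
    · exact Nat.cast_le.2 (card_le_card (union_subset (filter_subset _ _) (filter_subset _ _)))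
    · rw [Finset.disjoint_left]
      intro w hw hw'
      exact hc v hv w (mem_filter.1 hw).1 (mem_filter.1 hw).2 (mem_filter.1 hw').2.symm
  have h2 : ∑ v ∈ S, (#{w ∈ S | c w = c v} : ℝ) = ∑ i, (#{w ∈ S | c w = i} : ℝ) ^ 2 := by
    rw [← sum_fiberwise S c]
    refine sum_congr rfl fun i _ => ?_
    rw [sum_congr rfl (g := fun _ => (#{w ∈ S | c w = i} : ℝ))
      (fun v hv => by rw [(mem_filter.1 hv).2]), sum_const, nsmul_eq_mul, sq]
  have h3 : (#S : ℝ) = ∑ i, (#{w ∈ S | c w = i} : ℝ) := by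
    exact_mod_cast card_eq_sum_card_fiberwise (f := c) (t := univ) fun _ _ => mem_univ _
  have h4 := sq_sum_le_card_mul_sum_sq (s := (univ : Finset (Fin k)))
    (f := fun i => (#{w ∈ S | c w = i} : ℝ))
  rw [← h3, card_univ, Fintype.card_fin] at h4
  have h5 := sum_le_sum h1
  rw [sum_sub_distrib, h2, sum_const, nsmul_eq_mul] at h5
  have hk' : (0 : ℝ) < k := by exact_mod_cast hk
  rw [adjPairs, div_mul_eq_mul_div, le_div_iff₀ hk']
  push_cast
  nlinarith

/-- The upper bound in Simonovits' theorem on graphs with a critical edge, for the subgraphs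
induced by large sets of vertices. -/
theorem exists_forall_adjPairs_le {W : Type*} [Finite W] {k : ℕ} (hk : 2 ≤ k) {H : SimpleGraph W}
    (hχ : H.chromaticNumber = ((k + 1 : ℕ) : ℕ∞))
    (hcrit : ∃ e : Sym2 W, CycleCount.IsCriticalEdge H e) :
    ∃ N : ℕ, ∀ (V : Type) (G : SimpleGraph V) [DecidableRel G.Adj],
      H.Free G → ∀ S : Finset V, N ≤ #S →
        (G.adjPairs S : ℝ) ≤ ((k : ℝ) - 1) / k * #S ^ 2 := by
  classical
  have := Fintype.ofFinite W
  have hW : 1 ≤ Fintype.card W := by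
    obtain ⟨e, -⟩ := hcrit
    induction e with | h x y => exact Fintype.card_pos_iff.2 ⟨x⟩
  obtain ⟨N, hN⟩ := colorable_of_card_nonadj_le k (Fintype.card W) hk hW
  have hk' : (2 : ℝ) ≤ k := by exact_mod_cast hk
  set b : ℝ := ((k : ℝ) - 1) / k with hb
  have hb2 : 1 / 2 ≤ b := by
    rw [hb, div_le_div_iff₀ (by norm_num) (by linarith)]; linarith
  have hkb : 1 - b = 1 / k := by rw [hb]; field_simp; ring
  have hb1 : b ≤ 1 := by
    have : (0 : ℝ) ≤ 1 / k := by positivity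
    linarith
  refine ⟨N + 2 * N ^ 2, fun V G _ hG S hS => ?_⟩
  -- If all degrees inside S exceed b(|S| - 1), stability makes G[S] k-colourable, and the first
  -- alternative follows.
  have hdich : ∀ S : Finset V, N ≤ #S → (G.adjPairs S : ℝ) ≤ b * #S ^ 2 ∨
      ∃ v ∈ S, (#{w ∈ S | G.Adj v w} : ℝ) ≤ b * (#S - 1) := by
    intro S hS
    by_contra! hcon
    obtain ⟨h1, h2⟩ := hcon
    let f : {x // x ∈ S} ↪ V := Function.Embedding.subtype _
    have hcol : (G.comap f).Colorable k := by
      refine hN _ _ (by simpa using hS) ?_ fun h => hG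
        ((isContained_of_hasMultipartitePlusEdge hχ hcrit h).trans
          ⟨(Embedding.comap f G).toCopy⟩)
      intro v
      have h3 : #{w | ¬ (G.comap f).Adj v w} = #{w ∈ S | ¬ G.Adj v w} := by
        rw [← card_map f]
        congr 1
        ext w
        simp [f, and_comm]
      have h4 := card_filter_add_card_filter_not (s := S) (fun w => G.Adj v w)
      have h5 : (#{w ∈ S | G.Adj v w} : ℝ) + #{w ∈ S | ¬ G.Adj v w} = #S := by exact_mod_cast h4
      have h6 := h2 v v.2
      rw [h3, Fintype.card_coe, div_eq_mul_one_div, ← hkb]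
      linarith
    obtain ⟨c⟩ := hcol
    refine absurd (adjPairs_le_of_coloring (G := G) (S := S) (by omega : 1 ≤ k)
      (fun v => if h : v ∈ S then c ⟨v, h⟩ else ⟨0, by omega⟩) ?_) (not_le.2 h1)
    intro u hu v hv huv
    simp only [hu, hv, dif_pos]
    exact c.valid (by simpa [f] using huv)
  -- Restoring a vertex of degree at most bx turns bx² into at most b(x+1)² - b, and b ≥ 1/2. So the
  -- error, at most N² at size N, drops by 1/2 per vertex until it vanishes at size N + 2N².
  have hex : ∀ x, N ≤ x → ∀ S : Finset V, #S = x → (G.adjPairs S : ℝ) ≤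
      b * x ^ 2 + max 0 ((N : ℝ) ^ 2 - (x - N) / 2) := by
    intro x hx
    induction x, hx using Nat.le_induction with
    | base =>
      intro S hS
      have h1 : (G.adjPairs S : ℝ) ≤ (#S : ℝ) ^ 2 := by exact_mod_cast adjPairs_le_sq S
      rw [hS] at h1
      have h2 := le_max_right 0 ((N : ℝ) ^ 2 - (N - N) / 2)
      have h3 : 0 ≤ b * (N : ℝ) ^ 2 := by positivity
      linarith
    | succ x hx ih =>
      intro S hS
      rcases hdich S (by omega) with h | ⟨v, hv, hd⟩
      · rw [hS] at h
        have := le_max_left 0 ((N : ℝ) ^ 2 - ((x + 1 : ℕ) - N) / 2)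
        linarith
      · have h1 := ih (S.erase v) (by rw [card_erase_of_mem hv, hS]; rfl)
        have h2 : (G.adjPairs S : ℝ) =
            G.adjPairs (S.erase v) + 2 * #{w ∈ S | G.Adj v w} := by
          exact_mod_cast adjPairs_erase hv
        rw [hS] at hd
        push_cast at hd ⊢
        have h3 : max 0 ((N : ℝ) ^ 2 - (x - N) / 2) ≤
            max 0 ((N : ℝ) ^ 2 - (x + 1 - N) / 2) + 1 / 2 := by
          refine max_le (by positivity) ?_
          have := le_max_right 0 ((N : ℝ) ^ 2 - (x + 1 - N) / 2)
          linarith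
        nlinarith
  have h := hex #S (by omega) S rfl
  have hS' : (N : ℝ) + 2 * N ^ 2 ≤ #S := by exact_mod_cast hS
  rwa [max_eq_left (by linarith), add_zero] at h

end SimpleGraph

/-! ### Counting paths from a given vertex. -/

namespace SimpleGraph

variable {V : Type*} [DecidableEq V] (G : SimpleGraph V) [DecidableRel G.Adj]

/-- The vertex sequences of the paths of length `l` in `G` that start at `u` and stay inside
`S`. -/
def pathLists : ℕ → Finset V → V → Finset (List V)
  | 0, _, u => {[u]}
  | l + 1, S, u =>
    {w ∈ S | G.Adj u w}.biUnion fun w => (pathLists l (S.erase u) w).image (List.cons u)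

variable {G}

theorem support_mem_pathLists {u v : V} (q : G.Walk u v) (hq : q.IsPath) {S : Finset V}
    (hS : ∀ x ∈ q.support, x ∈ S) : q.support ∈ G.pathLists q.length S u := by
  induction q generalizing S with
  | nil => simp [pathLists]
  | @cons u w v h q ih =>
    rw [Walk.cons_isPath_iff] at hq
    simp only [Walk.length_cons, Walk.support_cons, pathLists]
    refine mem_biUnion.2 ⟨w, mem_filter.2 ⟨hS _ (by simp), h⟩, mem_image_of_mem _ ?_⟩
    refine ih hq.1 fun x hx => mem_erase.2 ⟨?_, hS _ (by simp [hx])⟩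
    rintro rfl
    exact hq.2 hx

/-- A uniform bound for the paths starting at the neighbours of `u` bounds the number of paths
starting at `u`. -/
theorem card_pathLists_succ_le {l : ℕ} {S : Finset V} {u : V} {B : ℝ}
    (hB : ∀ w ∈ S.erase u, (#(G.pathLists l (S.erase u) w) : ℝ) ≤ B) :
    (#(G.pathLists (l + 1) S u) : ℝ) ≤ #{w ∈ S | G.Adj u w} * B := by
  rw [pathLists]
  calc (#({w ∈ S | G.Adj u w}.biUnion fun w =>
        (G.pathLists l (S.erase u) w).image (List.cons u)) : ℝ)
      ≤ ∑ w ∈ S with G.Adj u w, (#(G.pathLists l (S.erase u) w) : ℝ) := by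
        exact_mod_cast card_biUnion_le.trans (sum_le_sum fun w _ => card_image_le)
    _ ≤ _ := by
        rw [← nsmul_eq_mul]
        refine sum_le_card_nsmul _ _ _ fun w hw => hB w (mem_erase.2 ?_)
        exact ⟨(mem_filter.1 hw).2.ne', (mem_filter.1 hw).1⟩

theorem card_filter_adj_le {S : Finset V} {u : V} (hu : u ∈ S) :
    #{w ∈ S | G.Adj u w} ≤ #S - 1 := by
  rw [← card_erase_of_mem hu]
  refine card_le_card fun w hw => mem_erase.2 ?_
  exact ⟨(mem_filter.1 hw).2.ne', (mem_filter.1 hw).1⟩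

theorem card_pathLists_le_factorial (l : ℕ) {S : Finset V} {u : V} (hu : u ∈ S) :
    #(G.pathLists l S u) ≤ (#S).factorial := by
  induction l generalizing S u with
  | zero =>
    rw [pathLists, card_singleton]
    exact Nat.factorial_pos _
  | succ l ih =>
    have h1 : (#(G.pathLists (l + 1) S u) : ℝ) ≤
        #{w ∈ S | G.Adj u w} * ((#S - 1).factorial : ℕ) := by
      refine card_pathLists_succ_le fun w hw => ?_
      rw [← card_erase_of_mem hu]
      exact_mod_cast ih hw
    have h2 : #(G.pathLists (l + 1) S u) ≤ #{w ∈ S | G.Adj u w} * (#S - 1).factorial := by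
      exact_mod_cast h1
    have h3 := card_pos.2 ⟨u, hu⟩
    calc _ ≤ _ := h2
      _ ≤ #S * (#S - 1).factorial :=
        Nat.mul_le_mul_right _ ((card_filter_adj_le hu).trans (Nat.sub_le _ _))
      _ = (#S).factorial := Nat.mul_factorial_pred h3.ne'

/-- This is 1 + x ≤ exp x. It lets a product of degrees be controlled by the number of edges; it is
sharp at d = c. -/
theorem le_mul_exp_div_sub_one {c : ℝ} (hc : 0 < c) (d : ℝ) : d ≤ c * Real.exp (d / c - 1) := by
  have := Real.add_one_le_exp (d / c - 1)
  rw [sub_add_cancel, div_le_iff₀ hc] at this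
  linarith

/-- The induction step of `card_pathLists_le`: d is the degree of the start, D twice the number of
edges left after its removal, and c = b(y+1). The rate 3/2 is 1 from exp(-1), plus 1 from (1 +
1/y)^y ≈ e, minus 1/2 from enlarging the denominator under D, where D ≤ by² enters. The term -1/y
telescopes and absorbs the lower order errors. -/
theorem mul_pow_mul_exp_le {b y d D : ℝ} {n : ℕ} (hn : 1 ≤ n) (hy : y = n) (hb : 0 < b)
    (hD : D ≤ b * y ^ 2) :
    d * ((b * y) ^ n * Real.exp (-(3 * y / 2) - 1 / y + D / (2 * b * y))) ≤
      (b * (y + 1)) ^ (n + 1) * Real.exp (-(3 * (y + 1) / 2) - 1 / (y + 1) +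
        (D + 2 * d) / (2 * b * (y + 1))) := by
  have hy1 : 1 ≤ y := by rw [hy]; exact_mod_cast hn
  have hy0 : 0 < y := by linarith
  have hp : (b * y) ^ n = Real.exp (y * Real.log (b * y)) := by
    rw [hy, Real.exp_nat_mul, Real.exp_log (by positivity)]
  have hp' : (b * (y + 1)) ^ n = Real.exp (y * Real.log (b * (y + 1))) := by
    rw [hy, Real.exp_nat_mul, Real.exp_log (by positivity)]
  have hlog : Real.log (b * (y + 1)) = Real.log (b * y) + Real.log (1 + 1 / y) := by
    rw [← Real.log_mul (by positivity) (by positivity)]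
    congr 1; field_simp
  have h1 := Real.le_log_one_add_of_nonneg (x := 1 / y) (by positivity)
  have h2 : 2 * (1 / y) / (1 / y + 2) = 2 / (2 * y + 1) := by field_simp; ring
  rw [h2] at h1
  have h3 : 1 - 1 / (2 * y + 1) ≤ y * Real.log (1 + 1 / y) := by
    calc 1 - 1 / (2 * y + 1) = y * (2 / (2 * y + 1)) := by field_simp; ring
      _ ≤ _ := by gcongr
  have h4 : 1 / (2 * y + 1) ≤ 1 / (2 * y) := by gcongr; linarith
  have h5 : D / (2 * b * y) - D / (2 * b * (y + 1)) ≤ 1 / 2 - 1 / (2 * (y + 1)) := by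
    calc D / (2 * b * y) - D / (2 * b * (y + 1)) = D / (2 * b * y * (y + 1)) := by
          field_simp; ring
      _ ≤ (b * y ^ 2) / (2 * b * y * (y + 1)) := by gcongr
      _ = 1 / 2 - 1 / (2 * (y + 1)) := by field_simp; ring
  have h6 : 1 / (2 * (y + 1)) ≤ 1 / (2 * y) := by gcongr; linarith
  have h7 : 1 / (2 * y) + 1 / (2 * y) = 1 / y := by field_simp; ring
  have h8 : 1 / (2 * (y + 1)) + 1 / (2 * (y + 1)) = 1 / (y + 1) := by field_simp; ring
  have h9 : (D + 2 * d) / (2 * b * (y + 1)) = D / (2 * b * (y + 1)) + d / (b * (y + 1)) := by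
    field_simp
  calc _ ≤ (b * (y + 1) * Real.exp (d / (b * (y + 1)) - 1)) *
        ((b * y) ^ n * Real.exp (-(3 * y / 2) - 1 / y + D / (2 * b * y))) := by
        gcongr
        exact le_mul_exp_div_sub_one (by positivity) d
    _ = b * (y + 1) * Real.exp (d / (b * (y + 1)) - 1 + y * Real.log (b * y) +
        (-(3 * y / 2) - 1 / y + D / (2 * b * y))) := by
        rw [hp, Real.exp_add (_ + _) (_ + _), Real.exp_add (_ - 1)]; ring
    _ ≤ b * (y + 1) * Real.exp (y * Real.log (b * (y + 1)) + (-(3 * (y + 1) / 2) - 1 / (y + 1) +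
        (D + 2 * d) / (2 * b * (y + 1)))) := by
        refine mul_le_mul_of_nonneg_left (Real.exp_le_exp.2 ?_) (by positivity)
        rw [hlog, h9, mul_add]
        linarith
    _ = _ := by
        rw [pow_succ, hp', Real.exp_add (y * _)]; ring

/-- Supplies the base cases, uniformly in b: paths of length zero, and sets too small for the edge
bound, where a factorial is used instead. -/
theorem exists_const_factorial_le (N : ℕ) (hN : 16 ≤ N) :
    ∃ K : ℝ, 0 < K ∧ ∀ b : ℝ, 1 / 2 ≤ b → ∀ x : ℕ, 1 ≤ x →
      1 ≤ K * ((b * x) ^ x * Real.exp (-(3 * (x : ℝ) / 2) - 1 / x)) ∧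
      (x ≤ N → (x.factorial : ℝ) ≤
        K * ((b * x) ^ x * Real.exp (-(3 * (x : ℝ) / 2) - 1 / x))) := by
  have hfac : (1 : ℝ) ≤ N.factorial := by exact_mod_cast N.factorial_pos
  have hK1 : 1 ≤ N.factorial * 2 ^ N * Real.exp (3 * (N : ℝ) / 2 + 1) :=
    one_le_mul_of_one_le_of_one_le (one_le_mul_of_one_le_of_one_le hfac
      (one_le_pow₀ (by norm_num))) (Real.one_le_exp (by positivity))
  refine ⟨N.factorial * 2 ^ N * Real.exp (3 * (N : ℝ) / 2 + 1), by positivity,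
    fun b hb x hx => ?_⟩
  have hx1 : (1 : ℝ) ≤ x := by exact_mod_cast hx
  have hinv : 1 / (x : ℝ) ≤ 1 := by rw [div_le_one (by positivity)]; exact hx1
  have hsmall : x ≤ N → (x.factorial : ℝ) ≤ N.factorial * 2 ^ N *
      Real.exp (3 * (N : ℝ) / 2 + 1) * ((b * x) ^ x * Real.exp (-(3 * (x : ℝ) / 2) - 1 / x)) := by
    intro hxN
    have hxN' : (x : ℝ) ≤ N := by exact_mod_cast hxN
    have h1 : (1 / 2 : ℝ) ^ N ≤ (b * x) ^ x := by
      calc (1 / 2 : ℝ) ^ N ≤ (1 / 2) ^ x :=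
            pow_le_pow_of_le_one (by norm_num) (by norm_num) hxN
        _ ≤ (b * x) ^ x := by gcongr; nlinarith
    calc (x.factorial : ℝ) ≤ N.factorial := by exact_mod_cast Nat.factorial_le hxN
      _ = N.factorial * 2 ^ N * Real.exp (3 * (N : ℝ) / 2 + 1) *
          ((1 / 2) ^ N * Real.exp (-(3 * (N : ℝ) / 2 + 1))) := by
          rw [Real.exp_neg, one_div, inv_pow]
          field_simp
      _ ≤ _ := by
          gcongr
          linarith
  refine ⟨?_, hsmall⟩
  rcases le_or_gt x N with hxN | hxN
  · exact (hsmall hxN).trans' (by exact_mod_cast x.factorial_pos)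
  · have hx16 : (16 : ℝ) ≤ x := by exact_mod_cast (by omega : 16 ≤ x)
    refine one_le_mul_of_one_le_of_one_le hK1 ?_
    -- Here bx ≥ 8 > e², which is the reason for 16.
    have h2 : Real.exp 2 ≤ b * x := by
      have h3 := Real.exp_one_lt_d9
      have h4 : Real.exp 2 = Real.exp 1 * Real.exp 1 := by rw [← Real.exp_add]; norm_num
      have h5 := Real.exp_pos 1
      nlinarith
    calc 1 ≤ Real.exp (x * 2 + (-(3 * (x : ℝ) / 2) - 1 / x)) := Real.one_le_exp (by linarith)
      _ = Real.exp 2 ^ x * Real.exp (-(3 * (x : ℝ) / 2) - 1 / x) := by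
          rw [Real.exp_add, Real.exp_nat_mul]
      _ ≤ _ := by gcongr

/-- If every large set `S` of vertices spans at most `b |S|² / 2` edges, then the number of paths
in `G[S]` from a given vertex is at most about `(b x)ˣ exp (-3x/2 + e / (b x))`, where `x = |S|`
and `e` is the number of edges inside `S`. -/
theorem card_pathLists_le {b K : ℝ} {N : ℕ} (hb : 1 / 2 ≤ b) (hK0 : 0 < K) (hN : 1 ≤ N)
    (hK : ∀ x : ℕ, 1 ≤ x → 1 ≤ K * ((b * x) ^ x * Real.exp (-(3 * (x : ℝ) / 2) - 1 / x)) ∧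
      (x ≤ N → (x.factorial : ℝ) ≤ K * ((b * x) ^ x * Real.exp (-(3 * (x : ℝ) / 2) - 1 / x))))
    (hG : ∀ S : Finset V, N ≤ #S → (G.adjPairs S : ℝ) ≤ b * #S ^ 2)
    (l : ℕ) {S : Finset V} {u : V} (hu : u ∈ S) :
    (#(G.pathLists l S u) : ℝ) ≤ K * ((b * #S) ^ #S *
      Real.exp (-(3 * (#S : ℝ) / 2) - 1 / #S + G.adjPairs S / (2 * b * #S))) := by
  have hmono : ∀ S : Finset V, K * ((b * #S) ^ #S * Real.exp (-(3 * (#S : ℝ) / 2) - 1 / #S)) ≤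
      K * ((b * #S) ^ #S *
        Real.exp (-(3 * (#S : ℝ) / 2) - 1 / #S + G.adjPairs S / (2 * b * #S))) := by
    intro S
    gcongr
    exact le_add_of_nonneg_right (by positivity)
  induction l generalizing S u with
  | zero =>
    refine (hmono S).trans' ?_
    simpa [pathLists] using (hK #S (card_pos.2 ⟨u, hu⟩)).1
  | succ l ih =>
    rcases le_or_gt #S N with hSN | hSN
    · refine (hmono S).trans' (((hK #S (card_pos.2 ⟨u, hu⟩)).2 hSN).trans' ?_)
      exact_mod_cast card_pathLists_le_factorial (l + 1) hu
    · obtain ⟨y, hy⟩ : ∃ y, #S = y + 1 := ⟨#S - 1, by omega⟩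
      have hy' : #(S.erase u) = y := by rw [card_erase_of_mem hu]; omega
      have h1 := card_pathLists_succ_le (G := G) (l := l) (S := S) (u := u)
        fun w hw => ih (S := S.erase u) (u := w) hw
      have h2 : (G.adjPairs S : ℝ) = G.adjPairs (S.erase u) + 2 * #{w ∈ S | G.Adj u w} := by
        exact_mod_cast adjPairs_erase hu
      have h3 := hG (S.erase u) (by omega)
      rw [hy'] at h1 h3
      have h4 := mul_pow_mul_exp_le (d := #{w ∈ S | G.Adj u w}) (by omega : 1 ≤ y) rfl
        (by linarith : 0 < b) h3
      rw [h2, hy]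
      push_cast
      refine h1.trans ?_
      rw [mul_left_comm]
      gcongr

/-- A bound for the number of paths starting at a given vertex in terms of a parameter `X`,
which stands for the number of unvisited vertices at which the degrees begin to decrease. -/
theorem card_pathLists_le_of_le_card {b K : ℝ} {N X : ℕ} (hb : 1 / 2 ≤ b) (hK0 : 0 < K)
    (hN : 1 ≤ N) (hX : 6 ≤ X)
    (hK : ∀ x : ℕ, 1 ≤ x → 1 ≤ K * ((b * x) ^ x * Real.exp (-(3 * (x : ℝ) / 2) - 1 / x)) ∧
      (x ≤ N → (x.factorial : ℝ) ≤ K * ((b * x) ^ x * Real.exp (-(3 * (x : ℝ) / 2) - 1 / x))))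
    (hG : ∀ S : Finset V, N ≤ #S → (G.adjPairs S : ℝ) ≤ b * #S ^ 2)
    (l : ℕ) {S : Finset V} {u : V} (hu : u ∈ S) (hXS : X ≤ #S) :
    (#(G.pathLists l S u) : ℝ) ≤ K * ((b * X) ^ #S *
      Real.exp (-(#S : ℝ) - X / 2 - 1 / X + G.adjPairs S / (2 * b * X))) := by
  have hX' : (6 : ℝ) ≤ X := by exact_mod_cast hX
  have hbX : 0 < b * X := by positivity
  -- Since bX ≥ 3, the bound does not decrease as |S| grows beyond X; the case of length zero relies
  -- on this, and it is why X ≥ 6.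
  have hbe : Real.exp 1 ≤ b * X := by
    have := Real.exp_one_lt_d9
    nlinarith
  induction l generalizing S u with
  | zero =>
    have h1 := (hK X (by omega)).1
    obtain ⟨y, hy⟩ := Nat.exists_eq_add_of_le hXS
    simp only [pathLists, card_singleton, Nat.cast_one]
    refine h1.trans ?_
    gcongr K * ?_
    calc (b * X) ^ X * Real.exp (-(3 * (X : ℝ) / 2) - 1 / X)
        = (b * X) ^ X * (Real.exp 1 ^ y *
            Real.exp (-(#S : ℝ) - X / 2 - 1 / X)) := by
          rw [← Real.exp_nat_mul, ← Real.exp_add, hy]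
          push_cast
          congr 2
          ring
      _ ≤ (b * X) ^ X * ((b * X) ^ y *
            Real.exp (-(#S : ℝ) - X / 2 - 1 / X + G.adjPairs S / (2 * b * X))) := by
          gcongr
          exact le_add_of_nonneg_right (by positivity)
      _ = _ := by rw [← mul_assoc, ← pow_add, hy]
  | succ l ih =>
    -- At |S| = X this bound coincides with that of `card_pathLists_le`, which takes over.
    rcases hXS.eq_or_lt with hXS | hXS
    · refine (card_pathLists_le hb hK0 hN hK hG (l + 1) hu).trans_eq ?_
      rw [← hXS]
      congr 3
      ring
    · obtain ⟨y, hy⟩ : ∃ y, #S = y + 1 := ⟨#S - 1, by omega⟩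
      have hy' : #(S.erase u) = y := by rw [card_erase_of_mem hu]; omega
      have h1 := card_pathLists_succ_le (G := G) (l := l) (S := S) (u := u)
        fun w hw => ih (S := S.erase u) (u := w) hw (by omega)
      have h2 : (G.adjPairs S : ℝ) = G.adjPairs (S.erase u) + 2 * #{w ∈ S | G.Adj u w} := by
        exact_mod_cast adjPairs_erase hu
      rw [hy'] at h1
      rw [h2, hy]
      push_cast
      set d : ℝ := (#{w ∈ S | G.Adj u w} : ℝ)
      set D : ℝ := (G.adjPairs (S.erase u) : ℝ)
      calc _ ≤ _ := h1
        _ ≤ (b * X * Real.exp (d / (b * X) - 1)) * (K * ((b * X) ^ y *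
              Real.exp (-(y : ℝ) - X / 2 - 1 / X + D / (2 * b * X)))) := by
            gcongr
            exact le_mul_exp_div_sub_one hbX d
        _ = K * ((b * X) ^ (y + 1) * Real.exp ((d / (b * X) - 1) +
              (-(y : ℝ) - X / 2 - 1 / X + D / (2 * b * X)))) := by
            rw [Real.exp_add (_ - 1), pow_succ]; ring
        _ = _ := by
            congr 3
            field_simp
            ring

end SimpleGraph

/-! ### From paths to cycles, and the choice of X. -/

namespace SimpleGraph

theorem numEdges_eq_card_edgeFinset {V : Type*} [Fintype V] (G : SimpleGraph V)
    [Fintype G.edgeSet] : CycleCount.numEdges G = #G.edgeFinset := by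
  rw [CycleCount.numEdges, Set.ncard_eq_toFinset_card', edgeFinset]

theorem adjPairs_univ {V : Type*} [Fintype V] (G : SimpleGraph V) [DecidableRel G.Adj] :
    G.adjPairs univ = 2 * CycleCount.numEdges G := by
  classical
  rw [numEdges_eq_card_edgeFinset, ← sum_degrees_eq_twice_card_edges, adjPairs]
  refine sum_congr rfl fun v _ => ?_
  rw [← card_neighborFinset_eq_degree, neighborFinset_eq_filter]

/-- The vertex sequence of a cycle with one edge removed recovers the cycle, as the missing edge
joins its first and last entries. -/
theorem numCycles_le_sum_card_pathLists {V : Type*} [Fintype V] [DecidableEq V]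
    (G : SimpleGraph V) [DecidableRel G.Adj] :
    CycleCount.numCycles G ≤ ∑ u, ∑ l ∈ range (Fintype.card V), #(G.pathLists l univ u) := by
  let P : Finset (List V) :=
    univ.biUnion fun u => (range (Fintype.card V)).biUnion fun l => G.pathLists l univ u
  have hP : #P ≤ ∑ u, ∑ l ∈ range (Fintype.card V), #(G.pathLists l univ u) :=
    card_biUnion_le.trans (sum_le_sum fun u _ => card_biUnion_le)
  refine le_trans ?_ hP
  have key : ∀ S ∈ {S : G.Subgraph | ∃ (v : V) (p : G.Walk v v), p.IsCycle ∧ p.toSubgraph = S},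
      ∃ L ∈ P, ∃ (v u : V) (h : G.Adj v u) (q : G.Walk u v), q.support = L ∧
        (Walk.cons h q).toSubgraph = S := by
    rintro S ⟨v, p, hp, rfl⟩
    cases p with
    | nil => exact absurd hp Walk.not_isCycle_nil
    | @cons _ u _ h q =>
      have hq : q.IsPath := ((Walk.cons_isCycle_iff q h).1 hp).1
      exact ⟨q.support, mem_biUnion.2 ⟨u, mem_univ _, mem_biUnion.2 ⟨q.length,
        mem_range.2 hq.length_lt, support_mem_pathLists q hq fun _ _ => mem_univ _⟩⟩,
        v, u, h, q, rfl, rfl⟩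
  choose! f hfP hf using key
  rw [← Set.ncard_coe_finset P]
  refine Set.ncard_le_ncard_of_injOn f hfP ?_ (Finset.finite_toSet P)
  intro S hS S' hS' hSS
  obtain ⟨v, u, h, q, hq, rfl⟩ := hf S hS
  obtain ⟨v', u', h', q', hq', rfl⟩ := hf S' hS'
  rw [← hq, ← hq'] at hSS
  have hu : u = u' := by
    have := hSS
    rw [← Walk.cons_tail_support q, ← Walk.cons_tail_support q'] at this
    exact (List.cons.inj this).1
  have hv : v = v' := by
    have := congrArg List.getLast? hSS
    rw [List.getLast?_eq_some_getLast (by simp), List.getLast?_eq_some_getLast (by simp)] at this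
    simpa using this
  subst hu hv
  rw [Walk.ext_support hSS]

theorem numCycles_eq_zero_of_numEdges_eq_zero {V : Type*} [Finite V] {G : SimpleGraph V}
    (h : CycleCount.numEdges G = 0) : CycleCount.numCycles G = 0 := by
  rw [CycleCount.numEdges, Set.ncard_eq_zero, edgeSet_eq_empty] at h
  rw [CycleCount.numCycles, ← Set.ncard_empty G.Subgraph]
  refine congrArg _ (Set.eq_empty_of_forall_notMem ?_)
  rintro S ⟨v, p, hp, -⟩
  cases p with
  | nil => exact Walk.not_isCycle_nil hp
  | cons hadj q =>
    subst h
    exact hadj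

/-- The near optimal choice of the parameter `X` in `card_pathLists_le_of_le_card`. -/
theorem exists_parameter {n : ℕ} (hn : 6 ≤ n) {lam μ : ℝ} (h0 : 0 < lam) (h1 : lam ≤ 1)
    (hμ : μ ≤ n ^ 2 * (lam - lam ^ 2 / 2)) :
    ∃ X : ℕ, 6 ≤ X ∧ X ≤ n ∧ (X : ℝ) ^ n * Real.exp (-(n : ℝ) - X / 2 + μ / X) ≤
      Real.exp 2 * ((lam * n) ^ n * Real.exp (2 / lam - lam * n)) := by
  have hn' : (6 : ℝ) ≤ n := by exact_mod_cast hn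
  have hn0 : (0 : ℝ) < n := by linarith
  set z := lam * n with hz
  have hz0 : 0 < z := by positivity
  have hzn : z ≤ n := by rw [hz]; nlinarith
  have hμ' : μ ≤ n * z - z ^ 2 / 2 := hμ.trans_eq (by rw [hz]; ring)
  have hlam : 1 / lam = n / z := by rw [hz]; field_simp
  have hlam2 : 2 / lam = 2 * (n / z) := by rw [hz]; field_simp
  have hlam0 : 0 < n / z := by positivity
  suffices h : ∃ X : ℕ, 6 ≤ X ∧ X ≤ n ∧
      n * Real.log (X / z) + (-(n : ℝ) - X / 2 + μ / X) ≤ 2 + (2 / lam - z) by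
    obtain ⟨X, hX6, hXn, h⟩ := h
    have hX0 : (0 : ℝ) < X := by exact_mod_cast (by omega : 0 < X)
    refine ⟨X, hX6, hXn, ?_⟩
    have h2 := Real.exp_le_exp.2 h
    rw [Real.exp_add (_ * _), Real.exp_add 2, Real.exp_nat_mul, Real.exp_log (by positivity),
      div_pow, div_mul_eq_mul_div, div_le_iff₀ (by positivity)] at h2
    exact h2.trans_eq (by ring)
  -- The ideal value is X = z = λn. If z is too small, X = 6 is used, and splitting 6/z as 3·(2/z)
  -- makes the loss exactly 2n/z = 2/λ; the other terms linear in n are nonpositive because 5/6 <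
  -- 0.89. Otherwise z is rounded up, at a cost of at most n/z = 1/λ.
  rcases le_or_gt z 5 with hz5 | hz5
  · refine ⟨6, le_rfl, hn, ?_⟩
    push_cast
    have hlog3 : Real.log 3 ≤ 1.11 := by
      have h2 := Real.log_le_sub_one_of_pos (x := 3 / Real.exp 1) (by positivity)
      rw [Real.log_div (by norm_num) (Real.exp_pos 1).ne', Real.log_exp] at h2
      have h3 : 3 / Real.exp 1 ≤ 1.11 := by
        rw [div_le_iff₀ (Real.exp_pos 1)]
        linarith [Real.exp_one_gt_d9]
      linarith
    have hlog : Real.log (6 / z) ≤ Real.log 3 + (2 / z - 1) := by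
      have h2 : 6 / z = 3 * (2 / z) := by ring
      rw [h2, Real.log_mul (by norm_num) (by positivity)]
      linarith [Real.log_le_sub_one_of_pos (x := 2 / z) (by positivity)]
    calc n * Real.log (6 / z) + (-(n : ℝ) - 6 / 2 + μ / 6)
        ≤ n * (1.11 + (2 / z - 1)) + (-(n : ℝ) - 6 / 2 + (n * z - z ^ 2 / 2) / 6) := by
          gcongr
          linarith
      _ = 2 * (n / z) + n * (z / 6 - 0.89) - 3 - z ^ 2 / 12 := by ring
      _ ≤ 2 + (2 / lam - z) := by
          rw [hlam2]
          nlinarith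
  · have hXz : z ≤ ⌈z⌉₊ := Nat.le_ceil z
    have hXz1 : (⌈z⌉₊ : ℝ) < z + 1 := Nat.ceil_lt_add_one hz0.le
    refine ⟨⌈z⌉₊, Nat.lt_ceil.2 (by exact_mod_cast hz5), Nat.ceil_le.2 hzn, ?_⟩
    set X : ℝ := (⌈z⌉₊ : ℝ)
    have hX0 : 0 < X := by linarith
    have hlog := Real.log_le_sub_one_of_pos (x := X / z) (by positivity)
    have hq : n * ((X - z) ^ 2 / (z * X)) ≤ n / z := by
      rw [div_eq_mul_one_div (n : ℝ) z]
      gcongr n * ?_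
      rw [div_le_div_iff₀ (by positivity) hz0]
      have : (X - z) ^ 2 ≤ X := by nlinarith
      nlinarith
    have hamgm : z ≤ X / 2 + z ^ 2 / (2 * X) := by
      have h2 : X / 2 + z ^ 2 / (2 * X) - z = (X - z) ^ 2 / (2 * X) := by field_simp; ring
      have h3 : 0 ≤ (X - z) ^ 2 / (2 * X) := by positivity
      linarith
    calc n * Real.log (X / z) + (-(n : ℝ) - X / 2 + μ / X)
        ≤ n * (X / z - 1) + (-(n : ℝ) - X / 2 + (n * z - z ^ 2 / 2) / X) := by gcongr
      _ = n * ((X - z) ^ 2 / (z * X)) - (X / 2 + z ^ 2 / (2 * X)) := by field_simp; ring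
      _ ≤ 2 + (2 / lam - z) := by rw [hlam2]; linarith

/-- The properties of `λ` that are used to count cycles. -/
theorem lam_bounds {k n m : ℕ} (hk : 2 ≤ k) (hn : 4 ≤ n) (hm : 0 < m)
    (hmt : m + 10 * n ≤ CycleCount.turanNumber k n) :
    0 < CycleCount.lam k n m ∧ CycleCount.lam k n m ≤ 1 ∧
      m / (((k : ℝ) - 1) / k) ≤
        n ^ 2 * (CycleCount.lam k n m - CycleCount.lam k n m ^ 2 / 2) := by
  have hk' : (2 : ℝ) ≤ k := by exact_mod_cast hk
  have hn' : (4 : ℝ) ≤ n := by exact_mod_cast hn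
  have hm' : (0 : ℝ) < m := by exact_mod_cast hm
  have hk1 : (0 : ℝ) < k - 1 := by linarith
  have hn3 : (0 : ℝ) < n - 3 := by linarith
  have hT : (2 * k * (m + 10 * n) : ℝ) ≤ (k - 1) * n ^ 2 := by
    have h1 := mul_card_edgeFinset_turanGraph_le (n := n) (r := k)
    rw [← numEdges_eq_card_edgeFinset] at h1
    have h2 : 2 * k * (m + 10 * n) ≤ (k - 1) * n ^ 2 :=
      (Nat.mul_le_mul_left _ hmt).trans h1
    have h3 : ((k - 1 : ℕ) : ℝ) = k - 1 := by rw [Nat.cast_sub (by omega), Nat.cast_one]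
    rw [← h3]
    exact_mod_cast h2
  set y : ℝ := 2 * (k : ℝ) / ((k : ℝ) - 1) * (m / ((n : ℝ) - 3) ^ 2) with hy
  have hy0 : 0 < y := by positivity
  -- The slack 10n in the hypothesis covers the passage from n² to (n-3)², so the square root is a
  -- genuine one.
  have hy1 : y ≤ 1 := by
    rw [hy, div_mul_div_comm, div_le_one (by positivity)]
    nlinarith
  have hsq := Real.sq_sqrt (sub_nonneg.2 hy1)
  have hs0 := Real.sqrt_nonneg (1 - y)
  have hs1 : √(1 - y) < 1 := by
    rw [Real.sqrt_lt' one_pos]; linarith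
  have hlam : CycleCount.lam k n m = 1 - √(1 - y) := rfl
  rw [hlam]
  refine ⟨by linarith, by linarith, ?_⟩
  -- λ is the smaller root of λ - λ²/2 = y/2.
  have h1 : (1 - √(1 - y)) - (1 - √(1 - y)) ^ 2 / 2 = y / 2 := by nlinarith
  rw [h1]
  have h2 : (m : ℝ) / (((k : ℝ) - 1) / k) = (n - 3) ^ 2 * (y / 2) := by
    rw [hy]; field_simp
  rw [h2]
  gcongr
  linarith

end SimpleGraph

/-! ### The bound for the number of cycles. -/

theorem lemma3p2 {W : Type*} [Finite W] (k : ℕ) (hk : 3 ≤ k + 1) (H : SimpleGraph W)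
    (hχ : H.chromaticNumber = ((k + 1 : ℕ) : ℕ∞))
    (hcrit : ∃ e : Sym2 W, CycleCount.IsCriticalEdge H e) :
    ∃ (C : ℝ) (N : ℕ), ∀ n : ℕ, N ≤ n → ∀ (G : SimpleGraph (Fin n)) (m : ℕ),
      H.Free G → CycleCount.numEdges G = m →
      CycleCount.beta k H * n ≤ m → m + 10 * n ≤ CycleCount.turanNumber k n →
      (CycleCount.numCycles G : ℝ) ≤
        C * (CycleCount.lam k n m ^ n * (n : ℝ) ^ (n + 2) * (((k : ℝ) - 1) / k) ^ n *
          Real.exp ((2 * (k : ℝ) - 1) / (((k : ℝ) - 1) * CycleCount.lam k n m) -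
            CycleCount.lam k n m * n)) := by
  classical
  have hk2 : 2 ≤ k := by omega
  have hk' : (2 : ℝ) ≤ k := by exact_mod_cast hk2
  have hk1 : (0 : ℝ) < k - 1 := by linarith
  obtain ⟨N, hN⟩ := exists_forall_adjPairs_le hk2 hχ hcrit
  obtain ⟨K, hK0, hK⟩ := exists_const_factorial_le (max N 16) (le_max_right _ _)
  refine ⟨K * Real.exp 2, 6, fun n hn G m hG hm _ hmt => ?_⟩
  -- For m = 0 also λ = 0, and the division by λ takes its default value; there are no cycles, so
  -- only nonnegativity is needed.
  rcases Nat.eq_zero_or_pos m with rfl | hm0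
  · rw [numCycles_eq_zero_of_numEdges_eq_zero hm, Nat.cast_zero]
    have : CycleCount.lam k n 0 = 0 := by simp [CycleCount.lam]
    rw [this]
    positivity
  obtain ⟨hl0, hl1, hμ⟩ := lam_bounds hk2 (by omega) hm0 hmt
  set L := CycleCount.lam k n m with hL
  set b : ℝ := ((k : ℝ) - 1) / k with hb
  have hb2 : 1 / 2 ≤ b := by
    rw [hb, div_le_div_iff₀ (by norm_num) (by linarith)]; linarith
  have hb0 : 0 < b := by linarith
  obtain ⟨X, hX6, hXn, hX⟩ := exists_parameter hn hl0 hl1 hμ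
  have hpaths : ∀ (l : ℕ) (u : Fin n), (#(G.pathLists l univ u) : ℝ) ≤
      K * (b ^ n * (Real.exp 2 * ((L * n) ^ n * Real.exp (2 / L - L * n)))) := by
    intro l u
    have h := card_pathLists_le_of_le_card (G := G) hb2 hK0
      ((by norm_num : 1 ≤ 16).trans (le_max_right N 16)) hX6
      (hK b hb2) (fun S hS => hN _ G hG S ((le_max_left _ _).trans hS)) l (mem_univ u)
      (by simpa using hXn)
    refine h.trans ?_
    rw [adjPairs_univ, hm, card_univ, Fintype.card_fin, mul_pow, mul_assoc]
    refine mul_le_mul_of_nonneg_left (mul_le_mul_of_nonneg_left (le_trans ?_ hX)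
      (by positivity)) hK0.le
    refine mul_le_mul_of_nonneg_left (Real.exp_le_exp.2 ?_) (by positivity)
    have h1 : ((2 * m : ℕ) : ℝ) / (2 * b * X) = m / b / X := by push_cast; field_simp
    have h2 : 0 ≤ 1 / (X : ℝ) := by positivity
    rw [h1]
    linarith
  have hexp : 2 / L ≤ (2 * (k : ℝ) - 1) / (((k : ℝ) - 1) * L) := by
    rw [div_le_div_iff₀ hl0 (by positivity)]
    nlinarith
  calc (CycleCount.numCycles G : ℝ)
      ≤ ∑ u : Fin n, ∑ l ∈ range n, (#(G.pathLists l univ u) : ℝ) := by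
        have := numCycles_le_sum_card_pathLists G
        rw [Fintype.card_fin] at this
        exact_mod_cast this
    _ ≤ ∑ u : Fin n, ∑ l ∈ range n,
        K * (b ^ n * (Real.exp 2 * ((L * n) ^ n * Real.exp (2 / L - L * n)))) :=
        sum_le_sum fun u _ => sum_le_sum fun l _ => hpaths l u
    -- The n starting vertices and n lengths account for the exponent n + 2.
    _ = K * Real.exp 2 * (L ^ n * (n : ℝ) ^ (n + 2) * b ^ n * Real.exp (2 / L - L * n)) := by
        simp only [sum_const, card_univ, Fintype.card_fin, card_range, nsmul_eq_mul]
        ring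
    _ ≤ _ := by gcongr
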